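/- Let $G$ be a finite simple graph with $n$ nodes. A \emph{round tube} of $G$ is a nonempty set of nodes whose induced subgraph is connected (the set of all nodes is allowed); a \emph{square tube} is a single node of $G$. Round and square tubes together are the \emph{design tubes} of $G$; a single node thus gives one round tube and one square tube. Two distinct design tubes are \emph{compatible} if either both are round and they neither intersect (overlap without one containing the other) nor are adjacent (disjoint with connected union), or at least one of them is square and neither of the two node sets contains the other (in particular they are not equal). A \emph{design tubing} of $G$ is a set of pairwise compatible design tubes; design tubings are ordered by $U \preceq U'$ if $U$ is obtained from $U'$ by adding tubes, that is, $U \supseteq U'$. Let $\square_G=[0,1]^n$ be the $n$-cube with coordinates $x_v$ indexed by the nodes $v$ of $G$; the facet $x_v=0$ represents $v$ as a round tube and the opposite facet $x_v=1$ represents $v$ as a square tube. A round tube $t$ labels the face $F_t=\{x\in\square_G : x_v=0 \text{ for all } v\in t\}$. To truncate a face $F$ of a polytope $P$ means to replace $P$ by its part on one side of a hyperplane which strictly separates $F$, on the removed side, from all vertices of $P$ not in $F$. A \emph{graph cubeahedron} $\mathcal C G$ is any polytope obtained from $\square_G$ by truncating successively all faces labeled by round tubes of $G$, in an order of (weakly)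 increasing dimension of the $F_t$; the face truncated in the step for $t$ is the remaining part $F_t\cap P$ of $F_t$ in the current polytope $P$, the order among faces of equal dimension is arbitrary, and so are the truncating hyperplanes. Then a graph cubeahedron of $G$ exists, and every graph cubeahedron $\mathcal C G$ of $G$ is a simple convex polytope of dimension $n$ whose poset of nonempty faces (including $\mathcal C G$ itself), ordered by inclusion, is isomorphic to the poset of design tubings of $G$. -/

import Mathlib

namespace GraphCubeahedron

section Polytopes

variable {E : Type*} [AddCommGroup E] [Module ℝ E]

/-- A convex polytope: the convex hull of a nonempty finite set of points. -/
def IsConvexPolytope (P : Set E) : Prop :=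
  ∃ s : Finset E, s.Nonempty ∧ P = convexHull ℝ (s : Set E)

/-- The dimension of a (nonempty) convex set: the dimension of its affine span. -/
noncomputable def polyDim (P : Set E) : ℕ :=
  Module.finrank ℝ (affineSpan ℝ P).direction

variable [TopologicalSpace E]

/-- `F` is a nonempty face of `P`: the nonempty set of points of `P` at which some linear
functional attains its maximum over `P`. The zero functional gives `P` itself. -/
def IsFace (P F : Set E) : Prop :=
  F.Nonempty ∧ IsExposed ℝ P F

/-- The face poset of `P`: its nonempty faces (including `P`), ordered by inclusion. -/
abbrev FacePoset (P : Set E) : Type _ :=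
  {F : Set E // IsFace P F}

/-- A facet of `P`: a face of codimension one. -/
def IsFacet (P F : Set E) : Prop :=
  IsFace P F ∧ polyDim F + 1 = polyDim P

/-- A simple polytope: a convex polytope of dimension `d` each of whose vertices lies on
exactly `d` facets. -/
def IsSimplePolytope (P : Set E) : Prop :=
  IsConvexPolytope P ∧
    ∀ x ∈ P.extremePoints ℝ, {F : Set E | IsFacet P F ∧ x ∈ F}.encard = (polyDim P : ℕ∞)

/-- `Q` is obtained from the polytope `P` by truncating its face `F`: it is the part of `P` on
one side of a hyperplane that strictly separates `F` from all vertices of `P` outside `F`. -/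
def IsTruncation (P F Q : Set E) : Prop :=
  IsFace P F ∧
    ∃ (l : StrongDual ℝ E) (c : ℝ),
      (∀ x ∈ F, c < l x) ∧ (∀ x ∈ P.extremePoints ℝ, x ∉ F → l x < c) ∧
        Q = {x ∈ P | l x ≤ c}

/-- `Q` is obtained from `P` by truncating successively the faces in the list. A face `F` of the
original polytope is represented in a later, already truncated, polytope by what is left of it. -/
def IsIteratedTruncation : Set E → List (Set E) → Set E → Prop
  | P, [], Q => Q = P
  | P, F :: L, Q => ∃ P', IsTruncation P (F ∩ P) P' ∧ IsIteratedTruncation P' L Q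

end Polytopes

section Graphs

variable {V : Type*} (G : SimpleGraph V)

/-- A round tube: a (nonempty) set of nodes whose induced subgraph is connected. -/
def IsRoundTube (t : Set V) : Prop :=
  (G.induce t).Connected

/-- The design tubes of `G`: the round tubes, and the square tubes, one for each node. -/
inductive DesignTube : Type _
  | round (t : Set V) (ht : IsRoundTube G t) : DesignTube
  | square (v : V) : DesignTube

variable {G}

/-- The set of nodes of a design tube. -/
def DesignTube.nodes : DesignTube G → Set V
  | .round t _ => t
  | .square v => {v}

/-- The tube is round. -/
def DesignTube.IsRound : DesignTube G → Prop
  | .round _ _ => True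
  | .square _ => False

/-- One of the two tubes contains the other (as sets of nodes, possibly equal). -/
def DesignTube.Nested (a b : DesignTube G) : Prop :=
  a.nodes ⊆ b.nodes ∨ b.nodes ⊆ a.nodes

/-- The tubes overlap, but neither contains the other. -/
def DesignTube.Intersect (a b : DesignTube G) : Prop :=
  (a.nodes ∩ b.nodes).Nonempty ∧ ¬ a.nodes ⊆ b.nodes ∧ ¬ b.nodes ⊆ a.nodes

/-- The tubes are disjoint and their union induces a connected subgraph. -/
def DesignTube.Adjacent (a b : DesignTube G) : Prop :=
  a.nodes ∩ b.nodes = ∅ ∧ IsRoundTube G (a.nodes ∪ b.nodes)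

/-- Compatibility of design tubes: two round tubes must neither be adjacent nor intersect; in
all other cases the tubes must not be nested. -/
def DesignTube.Compatible (a b : DesignTube G) : Prop :=
  (a.IsRound ∧ b.IsRound → ¬ a.Adjacent b ∧ ¬ a.Intersect b) ∧
    (¬ (a.IsRound ∧ b.IsRound) → ¬ a.Nested b)

variable (G)

/-- A design tubing: a set of design tubes any two (distinct) members of which are compatible. -/
@[ext]
structure DesignTubing where
  tubes : Set (DesignTube G)
  pairwise_compatible : tubes.Pairwise DesignTube.Compatible

/-- `U ≤ U'` if `U` is obtained from `U'` by adding tubes. -/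
instance : PartialOrder (DesignTubing G) where
  le U U' := U'.tubes ⊆ U.tubes
  le_refl _ := Set.Subset.rfl
  le_trans _ _ _ h h' := Set.Subset.trans h' h
  le_antisymm _ _ h h' := DesignTubing.ext (Set.Subset.antisymm h' h)

/-- The cube `[0, 1]^V`. For each node `v` the facet `x v = 0` represents `v` as a round tube,
and the opposite facet `x v = 1` represents `v` as a square tube. -/
def cube (V : Type*) : Set (V → ℝ) :=
  Set.Icc 0 1

/-- The face of the cube labeled by the set `t` of nodes, all chosen to be round: the
intersection of the facets that represent the nodes of `t` as round tubes. -/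
def roundFace (t : Set V) : Set (V → ℝ) :=
  {x ∈ cube V | ∀ v ∈ t, x v = 0}

/-- `P` is a graph cubeahedron of `G`: it is obtained from the cube by truncating, in some order
of increasing dimension, all the faces that are labeled by round tubes of `G`. The order within
one dimension and the truncating hyperplanes are arbitrary. -/
def IsGraphCubeahedron (P : Set (V → ℝ)) : Prop :=
  ∃ L : List (Set V),
    L.Nodup ∧ (∀ t, t ∈ L ↔ IsRoundTube G t) ∧
      L.Pairwise (fun s t => polyDim (roundFace s) ≤ polyDim (roundFace t)) ∧
        IsIteratedTruncation (cube V) (L.map roundFace) P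

end Graphs

end GraphCubeahedron

open GraphCubeahedron

/-! Every polytope in the process is presented by inequalities `l i x ≤ c i` whose tight functionals
are linearly independent at each of its points. Such a polytope is simple, and its face poset is the
opposite of the simplicial complex of those sets of inequalities that can be tight together
(`facePosetIso`). Truncating the face with label set τ adds one inequality j. No vertex lies on the
cutting hyperplane, so the presentation stays nondegenerate, and the complex undergoes a stellar
subdivision: sets containing τ disappear, and j joins a set σ exactly when σ ∪ τ was in the complex
and τ ⊄ σ. The choice of hyperplane leaves no trace in the complex.

What remains is combinatorial. `IsNestedFor T` describes the complex once the tubes in T are cut: a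
square node is neither round nor in a chosen tube, and no u ∈ T is covered by round nodes together
with chosen tubes properly inside u. Increasing dimension of faces means decreasing size of tubes;
hence the next tube t is no larger than any member of T, and t ∪ u ∈ T whenever t meets u ∈ T. These
two facts carry the description through each subdivision.

When all tubes are cut, the singletons rule out round labels, and the covering condition becomes
compatibility. Two incompatible round tubes cover their union, which is a tube. Conversely, if a
tube is covered by chosen proper subtubes, an edge leaving a maximal one of them reaches another
that is incompatible with it. -/

namespace GraphCubeahedron

/-! ### Linear functionals and extreme points. -/

section LinearAlgebra

variable {E : Type*} [NormedAddCommGroup E] [NormedSpace ℝ E]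

/-- Finitely many linearly independent functionals take arbitrary values simultaneously. -/
theorem exists_forall_apply_eq_of_linearIndependent {ι : Type*} [Finite ι]
    {f : ι → StrongDual ℝ E} (hf : LinearIndependent ℝ f) (a : ι → ℝ) :
    ∃ d, ∀ i, f i d = a i := by
  let g : StrongDual ℝ E →ₗ[ℝ] (E → ℝ) :=
    { toFun := fun φ => φ, map_add' := fun _ _ => rfl, map_smul' := fun _ _ => rfl }
  have hg : LinearMap.ker g = ⊥ :=
    LinearMap.ker_eq_bot.2 fun φ ψ h => ContinuousLinearMap.ext fun x => congrFun h x
  have hspan := span_flip_eq_top_iff_linearIndependent.2 (hf.map' g hg)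
  let A : E →ₗ[ℝ] (ι → ℝ) := LinearMap.pi fun i => (f i : E →ₗ[ℝ] ℝ)
  have hle : Submodule.span ℝ (Set.range (flip (g ∘ f))) ≤ LinearMap.range A := by
    rw [Submodule.span_le]
    rintro _ ⟨x, rfl⟩
    exact ⟨x, rfl⟩
  have : a ∈ LinearMap.range A := hle (hspan ▸ Submodule.mem_top)
  obtain ⟨d, hd⟩ := this
  exact ⟨d, fun i => congrFun hd i⟩

/-- The common kernel of a linearly independent family of functionals has the expected
dimension. -/
theorem finrank_iInf_ker_add [FiniteDimensional ℝ E] {ι : Type*} [Finite ι]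
    {f : ι → StrongDual ℝ E} (hf : LinearIndependent ℝ f) :
    Module.finrank ℝ (⨅ i, LinearMap.ker (f i : E →ₗ[ℝ] ℝ) : Submodule ℝ E) + Nat.card ι =
      Module.finrank ℝ E := by
  cases nonempty_fintype ι
  let A : E →ₗ[ℝ] (ι → ℝ) := LinearMap.pi fun i => (f i : E →ₗ[ℝ] ℝ)
  have hA : LinearMap.range A = ⊤ := by
    rw [LinearMap.range_eq_top]
    intro a
    obtain ⟨d, hd⟩ := exists_forall_apply_eq_of_linearIndependent hf a
    exact ⟨d, funext hd⟩
  have h := A.finrank_range_add_finrank_ker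
  rw [hA, finrank_top, Module.finrank_pi, LinearMap.ker_pi] at h
  rw [Nat.card_eq_fintype_card]
  omega

/-- A functional attains its maximum over a compact set at an extreme point. -/
theorem exists_extremePoint_isMax {K : Set E} (hK : IsCompact K) (hne : K.Nonempty)
    (m : StrongDual ℝ E) : ∃ x ∈ K.extremePoints ℝ, ∀ y ∈ K, m y ≤ m x := by
  obtain ⟨x₀, hx₀, hmax⟩ := hK.exists_isMaxOn hne m.continuous.continuousOn
  have hexp : IsExposed ℝ K (m.toExposed K) := ContinuousLinearMap.toExposed.isExposed
  obtain ⟨x, hx⟩ := (hexp.isCompact hK).extremePoints_nonempty ⟨x₀, hx₀, fun y hy => hmax hy⟩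
  exact ⟨x, hexp.isExtreme.extremePoints_subset_extremePoints hx, hx.1.2⟩

end LinearAlgebra

/-! ### Nondegenerate presentations and the faces of simple polytopes. -/

section Presentations

variable {E : Type*} [NormedAddCommGroup E] [NormedSpace ℝ E] {I : Type*}

/-- The solution set of the system of inequalities `l i x ≤ c i`. -/
def polyhedron (l : I → StrongDual ℝ E) (c : I → ℝ) : Set E :=
  {x | ∀ i, l i x ≤ c i}

/-- The inequalities that are equalities at `x`. -/
def tight (l : I → StrongDual ℝ E) (c : I → ℝ) (x : E) : Set I :=
  {i | l i x = c i}

/-- The face on which the inequalities in `σ` are equalities. -/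
def tightFace (l : I → StrongDual ℝ E) (c : I → ℝ) (σ : Set I) : Set E :=
  {x ∈ polyhedron l c | σ ⊆ tight l c x}

/-- The sets of inequalities which are simultaneously tight somewhere: the faces of the
dual simplicial complex of a simple polytope. -/
def tightComplex (l : I → StrongDual ℝ E) (c : I → ℝ) : Set (Set I) :=
  {σ | (tightFace l c σ).Nonempty}

/-- A nondegenerate presentation of a bounded polyhedron by inequalities. -/
structure IsSimplePresentation (l : I → StrongDual ℝ E) (c : I → ℝ) : Prop where
  isCompact : IsCompact (polyhedron l c)
  linearIndependent : ∀ x ∈ polyhedron l c,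
    LinearIndependent ℝ fun i : tight l c x => l i

variable {l : I → StrongDual ℝ E} {c : I → ℝ}

theorem convex_polyhedron : Convex ℝ (polyhedron l c) := by
  intro x hx y hy a b ha hb hab i
  simp only [map_add, map_smul, smul_eq_mul]
  have := mul_le_mul_of_nonneg_left (hx i) ha
  have := mul_le_mul_of_nonneg_left (hy i) hb
  have : c i = a * c i + b * c i := by rw [← add_mul, hab, one_mul]
  linarith

theorem tightFace_anti {σ σ' : Set I} (h : σ ⊆ σ') : tightFace l c σ' ⊆ tightFace l c σ :=
  fun _ hx => ⟨hx.1, h.trans hx.2⟩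

theorem mem_tightFace_tight {x : E} (hx : x ∈ polyhedron l c) :
    x ∈ tightFace l c (tight l c x) :=
  ⟨hx, subset_rfl⟩

theorem tightFace_empty : tightFace l c ∅ = polyhedron l c := by
  ext x; simp [tightFace]

theorem tightFace_inter (σ τ : Set I) :
    tightFace l c σ ∩ tightFace l c τ = tightFace l c (σ ∪ τ) := by
  ext x
  simp only [tightFace, Set.mem_inter_iff, Set.mem_ofPred_eq, Set.union_subset_iff]
  tauto

variable [Finite I]

/-- Moving a little from `x` in a direction `d` that does not increase the tight functionals. -/
theorem exists_pos_add_smul_mem {x : E} (hx : x ∈ polyhedron l c) {d : E}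
    (hd : ∀ i ∈ tight l c x, l i d ≤ 0) :
    ∃ ε : ℝ, 0 < ε ∧ x + ε • d ∈ polyhedron l c ∧
      tight l c (x + ε • d) = {i ∈ tight l c x | l i d = 0} := by
  have hev : ∀ i, ∀ᶠ ε in nhdsWithin (0 : ℝ) (Set.Ioi 0),
      i ∉ tight l c x → l i x + ε * l i d < c i := by
    intro i
    by_cases hi : i ∈ tight l c x
    · simp [hi]
    have hlt : l i x + 0 * l i d < c i := by
      simpa using lt_of_le_of_ne (hx i) hi
    have hcont : Continuous fun ε : ℝ => l i x + ε * l i d := by fun_prop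
    filter_upwards [nhdsWithin_le_nhds (hcont.continuousAt.eventually (gt_mem_nhds hlt))]
      with ε hε _ using hε
  obtain ⟨ε, hε, hpos⟩ := ((Filter.eventually_all.2 hev).and self_mem_nhdsWithin).exists
  have hpos : 0 < ε := hpos
  refine ⟨ε, hpos, fun i => ?_, ?_⟩
  · simp only [map_add, map_smul, smul_eq_mul]
    by_cases hi : i ∈ tight l c x
    · have h1 : l i x = c i := hi
      nlinarith [hd i hi]
    · exact (hε i hi).le
  · ext i
    simp only [tight, Set.mem_ofPred_eq, map_add, map_smul, smul_eq_mul]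
    by_cases hi : l i x = c i
    · simp [hi, hpos.ne']
    · simp [hi, (hε i hi).ne]

namespace IsSimplePresentation

/-- By independence there is a direction that keeps the inequalities of σ tight and strictly relaxes
all other tight ones. The resulting point lies in the relative interior of the face of σ. -/
theorem exists_tight_eq (h : IsSimplePresentation l c) {σ : Set I}
    (hσ : σ ∈ tightComplex l c) : ∃ y ∈ polyhedron l c, tight l c y = σ := by
  classical
  obtain ⟨x, hx, hσx⟩ := hσ
  obtain ⟨d, hd⟩ := exists_forall_apply_eq_of_linearIndependent (h.linearIndependent x hx)
    fun i => if (i : I) ∈ σ then 0 else -1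
  have hd' : ∀ i ∈ tight l c x, l i d = if i ∈ σ then 0 else -1 := fun i hi => hd ⟨i, hi⟩
  obtain ⟨ε, -, hmem, htight⟩ := exists_pos_add_smul_mem hx (d := d) fun i hi => by
    rw [hd' i hi]; split_ifs <;> norm_num
  refine ⟨_, hmem, htight.trans ?_⟩
  ext i
  constructor
  · rintro ⟨hi, h0⟩
    by_contra hiσ
    rw [hd' i hi, if_neg hiσ] at h0
    norm_num at h0
  · intro hi
    exact ⟨hσx hi, by rw [hd' i (hσx hi), if_pos hi]⟩

theorem tightFace_subset_iff (h : IsSimplePresentation l c) {σ σ' : Set I}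
    (hσ : σ ∈ tightComplex l c) : tightFace l c σ ⊆ tightFace l c σ' ↔ σ' ⊆ σ := by
  refine ⟨fun hsub => ?_, tightFace_anti⟩
  obtain ⟨y, hy, rfl⟩ := h.exists_tight_eq hσ
  exact (hsub (mem_tightFace_tight hy)).2

theorem isExposed_tightFace (σ : Set I) : IsExposed ℝ (polyhedron l c) (tightFace l c σ) := by
  classical
  cases nonempty_fintype I
  rintro ⟨w, hw⟩
  -- The sum over σ is at most the sum of the bounds, with equality only if every summand is tight.
  refine ⟨∑ i ∈ σ.toFinset, l i, Set.Subset.antisymm (fun x hx => ⟨hx.1, fun y hy => ?_⟩)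
    fun x hx => ⟨hx.1, fun i hi => ?_⟩⟩
  · simp only [FunLike.coe_sum, Finset.sum_apply]
    refine Finset.sum_le_sum fun i hi => ?_
    rw [show l i x = c i from hx.2 (Set.mem_toFinset.1 hi)]
    exact hy i
  · have hle := hx.2 w hw.1
    simp only [FunLike.coe_sum, Finset.sum_apply] at hle
    by_contra hne
    have hlt : ∑ i ∈ σ.toFinset, l i x < ∑ i ∈ σ.toFinset, l i w := by
      refine Finset.sum_lt_sum (fun j hj => ?_) ⟨i, Set.mem_toFinset.2 hi, ?_⟩
      · rw [show l j w = c j from hw.2 (Set.mem_toFinset.1 hj)]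
        exact hx.1 j
      · rw [show l i w = c i from hw.2 hi]
        exact lt_of_le_of_ne (hx.1 i) hne
    exact absurd hle hlt.not_ge

theorem isFace_tightFace {σ : Set I} (hσ : σ ∈ tightComplex l c) :
    IsFace (polyhedron l c) (tightFace l c σ) :=
  ⟨hσ, isExposed_tightFace σ⟩

theorem isCompact_tightFace (h : IsSimplePresentation l c) (σ : Set I) :
    IsCompact (tightFace l c σ) :=
  (isExposed_tightFace σ).isCompact h.isCompact

theorem convex_tightFace (σ : Set I) : Convex ℝ (tightFace l c σ) :=
  (isExposed_tightFace σ).convex convex_polyhedron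

theorem extremePoints_tightFace_subset (σ : Set I) :
    (tightFace l c σ).extremePoints ℝ ⊆ (polyhedron l c).extremePoints ℝ :=
  (isExposed_tightFace σ).isExtreme.extremePoints_subset_extremePoints

/-- Every nonempty face is cut out by turning some inequalities into equalities. -/
theorem exists_eq_tightFace {F : Set E} (hF : IsFace (polyhedron l c) F) :
    ∃ σ ∈ tightComplex l c, F = tightFace l c σ := by
  obtain ⟨hne, hexp⟩ := hF
  obtain ⟨m, hm⟩ := hexp hne
  -- A point of F with minimal tight set plays the role of a relative interior point: the midpoint
  -- with any z ∈ F is tight only where both ends are.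
  obtain ⟨σ, ⟨x, hxF, rfl⟩, hmin⟩ :=
    (Set.toFinite (tight l c '' F)).exists_minimal (hne.image _)
  have hxP : x ∈ polyhedron l c := hexp.subset hxF
  refine ⟨tight l c x, ⟨x, mem_tightFace_tight hxP⟩, Set.Subset.antisymm ?_ ?_⟩
  · intro z hz
    refine ⟨hexp.subset hz, ?_⟩
    have hmid : (1 / 2 : ℝ) • x + (1 / 2 : ℝ) • z ∈ F :=
      hexp.convex convex_polyhedron hxF hz (by norm_num) (by norm_num) (by norm_num)
    have htight : ∀ i ∈ tight l c ((1 / 2 : ℝ) • x + (1 / 2 : ℝ) • z),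
        i ∈ tight l c x ∧ i ∈ tight l c z := by
      intro i hi
      simp only [tight, Set.mem_ofPred_eq, map_add, map_smul, smul_eq_mul] at hi ⊢
      have h1 := hxP i
      have h2 := hexp.subset hz i
      constructor <;> linarith
    exact (hmin ⟨_, hmid, rfl⟩ fun i hi => (htight i hi).1).trans fun i hi => (htight i hi).2
  · intro y hy
    -- The segment from y to x can be prolonged beyond x inside the polyhedron. Since m is maximal
    -- at x, it cannot be smaller at y.
    obtain ⟨ε, hε, hmem, -⟩ := exists_pos_add_smul_mem hxP (d := x - y) fun i hi => by
      rw [map_sub, show l i x = c i from hi, show l i y = c i from hy.2 hi, sub_self]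
    rw [hm] at hxF ⊢
    have h1 := hxF.2 _ hmem
    simp only [map_add, map_smul, map_sub, smul_eq_mul] at h1
    have h2 : m x ≤ m y := by
      by_contra hlt
      have := mul_pos hε (sub_pos.2 (not_le.1 hlt))
      linarith
    exact ⟨hy.1, fun z hz => (hxF.2 z hz).trans h2⟩

/-- The face poset of a simply presented polytope is the opposite of its dual complex. -/
noncomputable def facePosetIso (h : IsSimplePresentation l c) :
    (tightComplex l c)ᵒᵈ ≃o FacePoset (polyhedron l c) where
  toEquiv := Equiv.ofBijective
    (fun σ => ⟨tightFace l c (OrderDual.ofDual σ).1, isFace_tightFace (OrderDual.ofDual σ).2⟩) <| by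
      constructor
      · intro σ σ' heq
        have heq' := congrArg Subtype.val heq
        exact Subtype.ext (Set.Subset.antisymm
          ((h.tightFace_subset_iff (OrderDual.ofDual σ').2).1 heq'.ge)
          ((h.tightFace_subset_iff (OrderDual.ofDual σ).2).1 heq'.le))
      · rintro ⟨F, hF⟩
        obtain ⟨σ, hσ, rfl⟩ := exists_eq_tightFace hF
        exact ⟨OrderDual.toDual ⟨σ, hσ⟩, rfl⟩
  map_rel_iff' := fun {σ _} => h.tightFace_subset_iff (OrderDual.ofDual σ).2

theorem vectorSpan_tightFace (h : IsSimplePresentation l c) {σ : Set I}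
    (hσ : σ ∈ tightComplex l c) :
    vectorSpan ℝ (tightFace l c σ) = ⨅ i : σ, LinearMap.ker (l i : E →ₗ[ℝ] ℝ) := by
  apply le_antisymm
  · rw [vectorSpan, Submodule.span_le]
    rintro _ ⟨x, hx, y, hy, rfl⟩
    simp only [SetLike.mem_coe, Submodule.mem_iInf, LinearMap.mem_ker]
    intro i
    have h1 : l i x = c i := hx.2 i.2
    have h2 : l i y = c i := hy.2 i.2
    simp [h1, h2]
  · intro d hd
    simp only [Submodule.mem_iInf, LinearMap.mem_ker] at hd
    obtain ⟨y, hy, hyσ⟩ := h.exists_tight_eq hσ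
    have hd' : ∀ i ∈ tight l c y, l i d = 0 := fun i hi => hd ⟨i, hyσ ▸ hi⟩
    obtain ⟨ε, hε, hmem, ht⟩ := exists_pos_add_smul_mem hy fun i hi => (hd' i hi).le
    have hmem' : y + ε • d ∈ tightFace l c σ :=
      ⟨hmem, fun i hi => ht.ge ⟨hyσ.ge hi, hd' i (hyσ.ge hi)⟩⟩
    have hsub := vsub_mem_vectorSpan ℝ hmem' (show y ∈ tightFace l c σ from ⟨hy, hyσ.ge⟩)
    rw [vsub_eq_sub, add_sub_cancel_left] at hsub
    simpa [smul_smul, hε.ne'] using Submodule.smul_mem _ ε⁻¹ hsub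

theorem polyDim_tightFace_add [FiniteDimensional ℝ E] (h : IsSimplePresentation l c) {σ : Set I}
    (hσ : σ ∈ tightComplex l c) :
    polyDim (tightFace l c σ) + σ.ncard = Module.finrank ℝ E := by
  obtain ⟨y, hy, hyσ⟩ := h.exists_tight_eq hσ
  have hli := h.linearIndependent y hy
  rw [hyσ] at hli
  rw [polyDim, direction_affineSpan, h.vectorSpan_tightFace hσ, ← finrank_iInf_ker_add hli]
  rfl

theorem polyDim_polyhedron [FiniteDimensional ℝ E] (h : IsSimplePresentation l c)
    (hne : (polyhedron l c).Nonempty) : polyDim (polyhedron l c) = Module.finrank ℝ E := by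
  rw [← tightFace_empty] at hne ⊢
  simpa using h.polyDim_tightFace_add hne

/-- Otherwise one could move from x a little both ways along y - x, putting x inside a segment of
the polyhedron. -/
theorem eq_of_forall_tight_apply_eq {x y : E} (hx : x ∈ (polyhedron l c).extremePoints ℝ)
    (hy : ∀ i ∈ tight l c x, l i y = c i) : y = x := by
  have h0 : ∀ i ∈ tight l c x, l i (y - x) = 0 := fun i hi => by
    rw [map_sub, hy i hi, show l i x = c i from hi, sub_self]
  obtain ⟨ε, hε, h1, -⟩ := exists_pos_add_smul_mem hx.1 (d := y - x) fun i hi => (h0 i hi).le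
  obtain ⟨δ, hδ, h2, -⟩ := exists_pos_add_smul_mem hx.1 (d := -(y - x)) fun i hi => by
    rw [map_neg, h0 i hi, neg_zero]
  have hmem : x ∈ openSegment ℝ (x + ε • (y - x)) (x + δ • -(y - x)) := by
    refine ⟨δ / (ε + δ), ε / (ε + δ), by positivity, by positivity, by field_simp; ring, ?_⟩
    have hs : (δ / (ε + δ)) + (ε / (ε + δ)) = 1 := by field_simp; ring
    have hz : (δ / (ε + δ)) * ε - (ε / (ε + δ)) * δ = 0 := by field_simp; ring
    calc _ = ((δ / (ε + δ)) + (ε / (ε + δ))) • x +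
          ((δ / (ε + δ)) * ε - (ε / (ε + δ)) * δ) • (y - x) := by module
      _ = x := by rw [hs, hz]; simp
  have heq := hx.2 h1 h2 hmem
  have : ε • (y - x) = 0 := by simpa using heq
  rcases smul_eq_zero.1 this with h | h
  · exact absurd h hε.ne'
  · exact sub_eq_zero.1 h

theorem finite_extremePoints_polyhedron : ((polyhedron l c).extremePoints ℝ).Finite := by
  refine Set.Finite.of_finite_image (Set.toFinite (tight l c '' _)) fun x hx y _ hxy => ?_
  exact (eq_of_forall_tight_apply_eq hx fun i hi => hxy.le hi).symm

theorem isConvexPolytope (h : IsSimplePresentation l c) (hne : (polyhedron l c).Nonempty) :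
    IsConvexPolytope (polyhedron l c) := by
  have hfin := finite_extremePoints_polyhedron (l := l) (c := c)
  refine ⟨hfin.toFinset, ?_, ?_⟩
  · rw [Set.Finite.toFinset_nonempty]
    exact h.isCompact.extremePoints_nonempty hne
  · rw [Set.Finite.coe_toFinset, ← (hfin.isCompact_convexHull (𝕜 := ℝ)).isClosed.closure_eq,
      closure_convexHull_extremePoints h.isCompact convex_polyhedron]

theorem ncard_tight_of_mem_extremePoints [FiniteDimensional ℝ E] (h : IsSimplePresentation l c)
    {x : E} (hx : x ∈ (polyhedron l c).extremePoints ℝ) :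
    (tight l c x).ncard = Module.finrank ℝ E := by
  rw [← h.polyDim_tightFace_add ⟨x, mem_tightFace_tight hx.1⟩]
  have : tightFace l c (tight l c x) = {x} := by
    ext y
    constructor
    · exact fun hy => eq_of_forall_tight_apply_eq hx fun i hi => hy.2 hi
    · rintro rfl
      exact mem_tightFace_tight hx.1
  rw [this, polyDim, direction_affineSpan, vectorSpan_singleton, finrank_bot, zero_add]

theorem isFacet_iff [FiniteDimensional ℝ E] (h : IsSimplePresentation l c) {F : Set E} :
    IsFacet (polyhedron l c) F ↔ ∃ i, {i} ∈ tightComplex l c ∧ F = tightFace l c {i} := by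
  constructor
  · rintro ⟨hF, hdim⟩
    obtain ⟨σ, hσ, rfl⟩ := exists_eq_tightFace hF
    have h1 := h.polyDim_tightFace_add hσ
    rw [h.polyDim_polyhedron (hσ.mono fun _ hx => hx.1)] at hdim
    obtain ⟨i, rfl⟩ := Set.ncard_eq_one.1 (show σ.ncard = 1 by omega)
    exact ⟨i, hσ, rfl⟩
  · rintro ⟨i, hi, rfl⟩
    refine ⟨isFace_tightFace hi, ?_⟩
    have h1 := h.polyDim_tightFace_add hi
    rw [h.polyDim_polyhedron (hi.mono fun _ hx => hx.1), ← h1, Set.ncard_singleton]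

theorem isSimplePolytope [FiniteDimensional ℝ E] (h : IsSimplePresentation l c)
    (hne : (polyhedron l c).Nonempty) : IsSimplePolytope (polyhedron l c) := by
  refine ⟨h.isConvexPolytope hne, fun x hx => ?_⟩
  -- The facets through a vertex correspond to its tight inequalities, whose number is the
  -- dimension.
  have hset : {F : Set E | IsFacet (polyhedron l c) F ∧ x ∈ F} =
      (fun i => tightFace l c {i}) '' tight l c x := by
    ext F
    constructor
    · rintro ⟨hF, hxF⟩
      obtain ⟨i, -, rfl⟩ := h.isFacet_iff.1 hF
      exact ⟨i, hxF.2 rfl, rfl⟩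
    · rintro ⟨i, hi, rfl⟩
      have hxi : x ∈ tightFace l c {i} := ⟨hx.1, Set.singleton_subset_iff.2 hi⟩
      exact ⟨h.isFacet_iff.2 ⟨i, ⟨x, hxi⟩, rfl⟩, hxi⟩
  have hinj : Set.InjOn (fun i => tightFace l c {i}) (tight l c x) := by
    intro i hi j _ hij
    have hi' : {i} ∈ tightComplex l c := ⟨x, hx.1, Set.singleton_subset_iff.2 hi⟩
    exact (Set.mem_singleton_iff.1 ((h.tightFace_subset_iff hi').1 (Eq.le hij) rfl)).symm
  rw [hset, hinj.encard_image, h.polyDim_polyhedron hne, ← h.ncard_tight_of_mem_extremePoints hx,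
    (Set.toFinite _).cast_ncard_eq]

end IsSimplePresentation

end Presentations

end GraphCubeahedron

namespace GraphCubeahedron

/-! ### Truncation as stellar subdivision of the dual complex. -/

section Truncation

variable {E : Type*} [NormedAddCommGroup E] [NormedSpace ℝ E] {I : Type*}
  {l : I → StrongDual ℝ E} {c : I → ℝ}

section FiniteIndex

variable [Finite I]

namespace IsSimplePresentation

theorem exists_extremePoint_notMem_tightFace (h : IsSimplePresentation l c) {σ τ : Set I}
    (hσ : σ ∈ tightComplex l c) (hτ : ¬ τ ⊆ σ) :
    ∃ x ∈ (polyhedron l c).extremePoints ℝ, x ∈ tightFace l c σ ∧ x ∉ tightFace l c τ := by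
  obtain ⟨y, hy, hyσ⟩ := h.exists_tight_eq hσ
  obtain ⟨i, hiτ, hiσ⟩ := Set.not_subset.1 hτ
  -- Minimising `l i` for some i ∈ τ outside σ gives a vertex where i is slack, since i is already
  -- slack at the interior point y.
  obtain ⟨x, hx, hmax⟩ := exists_extremePoint_isMax (h.isCompact_tightFace σ) hσ (-l i)
  refine ⟨x, extremePoints_tightFace_subset σ hx, hx.1, fun hxτ => ?_⟩
  have h1 := hmax y ⟨hy, hyσ.ge⟩
  have h2 : l i x = c i := hxτ.2 hiτ
  have h3 : l i y < c i := lt_of_le_of_ne (hy i) fun heq => hiσ (hyσ.le heq)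
  simp only [neg_apply] at h1
  linarith

/-- Any face of a simple polytope other than the polytope itself can be truncated. -/
theorem exists_isTruncation {τ : Set I} (hτ : τ ∈ tightComplex l c) :
    ∃ Q, IsTruncation (polyhedron l c) (tightFace l c τ) Q := by
  obtain ⟨m, hm⟩ := isExposed_tightFace (l := l) (c := c) τ hτ
  obtain ⟨w, hw⟩ := hτ
  have hfin := (finite_extremePoints_polyhedron (l := l) (c := c)).subset
    (Set.sdiff_subset (t := tightFace l c τ))
  have hlt : ∀ x ∈ (polyhedron l c).extremePoints ℝ \ tightFace l c τ, m x < m w := by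
    rintro x ⟨hx, hxτ⟩
    by_contra hle
    rw [hm] at hw hxτ
    exact hxτ ⟨hx.1, fun y hy => (hw.2 y hy).trans (not_lt.1 hle)⟩
  -- Only finitely many vertices must stay below the cut, so any level just under the maximum of m
  -- works.
  have hev : ∀ᶠ b in nhdsWithin (m w) (Set.Iio (m w)),
      ∀ x ∈ (polyhedron l c).extremePoints ℝ \ tightFace l c τ, m x < b :=
    (Set.Finite.eventually_all hfin).2 fun x hx =>
      nhdsWithin_le_nhds (lt_mem_nhds (hlt x hx))
  obtain ⟨b, hb, hbw⟩ := (hev.and self_mem_nhdsWithin).exists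
  refine ⟨_, isFace_tightFace ⟨w, hw⟩, m, b, fun x hx => ?_, fun x hx hxτ => hb x ⟨hx, hxτ⟩, rfl⟩
  rw [hm] at hx
  exact lt_of_lt_of_le hbw (hx.2 w hw.1)

end IsSimplePresentation

end FiniteIndex

variable {j : I}

/-- A label not yet in use carries the void inequality 0 ≤ 1. The index type thus stays fixed, and a
truncation is a `Function.update` at such a label. -/
theorem notMem_tight_of_eq_zero (hj : l j = 0) (hcj : c j = 1) (x : E) : j ∉ tight l c x := by
  simp [tight, hj, hcj]

variable [DecidableEq I] {τ : Set I} {m : StrongDual ℝ E} {b : ℝ}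

theorem polyhedron_update (hj : l j = 0) (hcj : c j = 1) :
    polyhedron (Function.update l j m) (Function.update c j b) =
      {x ∈ polyhedron l c | m x ≤ b} := by
  ext x
  constructor
  · intro hx
    refine ⟨fun i => ?_, by simpa using hx j⟩
    by_cases hi : i = j
    · subst hi; simp [hj, hcj]
    · simpa [hi] using hx i
  · rintro ⟨hx, hxm⟩ i
    by_cases hi : i = j
    · subst hi; simpa using hxm
    · simpa [hi] using hx i

theorem mem_tight_update_of_ne {i : I} (hi : i ≠ j) (x : E) :
    i ∈ tight (Function.update l j m) (Function.update c j b) x ↔ i ∈ tight l c x := by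
  simp [tight, hi]

theorem mem_tight_update_self (x : E) :
    j ∈ tight (Function.update l j m) (Function.update c j b) x ↔ m x = b := by
  simp [tight]

theorem tight_update_of_ne (hj : l j = 0) (hcj : c j = 1) {x : E} (hx : m x ≠ b) :
    tight (Function.update l j m) (Function.update c j b) x = tight l c x := by
  ext i
  by_cases hi : i = j
  · subst hi
    simp [mem_tight_update_self, hx, notMem_tight_of_eq_zero hj hcj]
  · exact mem_tight_update_of_ne hi x

theorem tight_update_of_eq (hj : l j = 0) (hcj : c j = 1) {x : E} (hx : m x = b) :
    tight (Function.update l j m) (Function.update c j b) x = insert j (tight l c x) := by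
  ext i
  by_cases hi : i = j
  · subst hi
    simp [mem_tight_update_self, hx]
  · simp [mem_tight_update_of_ne hi, hi]

theorem tightFace_update (hj : l j = 0) (hcj : c j = 1) {σ : Set I} (hσ : j ∉ σ) :
    tightFace (Function.update l j m) (Function.update c j b) σ =
      {x ∈ tightFace l c σ | m x ≤ b} := by
  ext x
  have : σ ⊆ tight (Function.update l j m) (Function.update c j b) x ↔ σ ⊆ tight l c x :=
    forall₂_congr fun i hi => mem_tight_update_of_ne (ne_of_mem_of_not_mem hi hσ) x
  simp only [tightFace, polyhedron_update hj hcj, Set.mem_ofPred_eq, this]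
  tauto

theorem tightFace_update_insert (hj : l j = 0) (hcj : c j = 1) {σ : Set I} (hσ : j ∉ σ) :
    tightFace (Function.update l j m) (Function.update c j b) (insert j σ) =
      {x ∈ tightFace l c σ | m x = b} := by
  rw [Set.insert_eq, ← tightFace_inter, tightFace_update hj hcj hσ]
  ext x
  simp only [tightFace, polyhedron_update hj hcj, Set.mem_inter_iff, Set.mem_ofPred_eq,
    Set.singleton_subset_iff, mem_tight_update_self]
  constructor
  · rintro ⟨⟨-, h1⟩, h2, -⟩
    exact ⟨h2, h1⟩
  · rintro ⟨h1, h2⟩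
    exact ⟨⟨⟨h1.1, h2.le⟩, h2⟩, h1, h2.le⟩

variable [Finite I]

namespace IsSimplePresentation

/-- Truncating a face of a simply presented polytope adds an inequality to the presentation. -/
theorem update (h : IsSimplePresentation l c) (hj : l j = 0) (hcj : c j = 1)
    (hF : ∀ x ∈ tightFace l c τ, b < m x)
    (hV : ∀ x ∈ (polyhedron l c).extremePoints ℝ, x ∉ tightFace l c τ → m x < b) :
    IsSimplePresentation (Function.update l j m) (Function.update c j b) where
  isCompact := by
    rw [polyhedron_update hj hcj]
    exact h.isCompact.inter_right (isClosed_le m.continuous continuous_const)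
  linearIndependent := by
    intro x hx
    rw [polyhedron_update hj hcj] at hx
    have hli : LinearIndepOn ℝ l (tight l c x) := h.linearIndependent x hx.1
    change LinearIndepOn ℝ (Function.update l j m) (tight _ _ x)
    have hnot : j ∉ tight l c x := notMem_tight_of_eq_zero hj hcj x
    have hli' : LinearIndepOn ℝ (Function.update l j m) (tight l c x) :=
      hli.congr fun i hi =>
        (Function.update_of_ne (ne_of_mem_of_not_mem hi hnot) _ _).symm
    by_cases hxb : m x = b
    · rw [tight_update_of_eq hj hcj hxb]
      refine hli'.insert fun hmem => ?_
      rw [Function.update_self] at hmem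
      have himg : Function.update l j m '' tight l c x = l '' tight l c x :=
        Set.image_congr fun i hi => Function.update_of_ne (ne_of_mem_of_not_mem hi hnot) _ _
      rw [himg] at hmem
      -- If m depended on the functionals tight at x, it would equal b on their whole face, hence at
      -- a vertex; but every vertex is strictly on one side of the cut.
      have hconst : ∀ y ∈ tightFace l c (tight l c x), m (y - x) = 0 := by
        intro y hy
        refine Submodule.span_induction (p := fun φ _ => φ (y - x) = 0) ?_ ?_ ?_ ?_ hmem
        · rintro _ ⟨i, hi, rfl⟩
          rw [map_sub, show l i x = c i from hi, show l i y = c i from hy.2 hi, sub_self]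
        · simp
        · intro φ ψ _ _ h1 h2
          simp [h1, h2]
        · intro a φ _ h1
          simp [h1]
      obtain ⟨y, hy⟩ := (h.isCompact_tightFace (tight l c x)).extremePoints_nonempty
        ⟨x, mem_tightFace_tight hx.1⟩
      have hmy := hconst y hy.1
      rw [map_sub, hxb] at hmy
      by_cases hyF : y ∈ tightFace l c τ
      · linarith [hF y hyF]
      · linarith [hV y (extremePoints_tightFace_subset _ hy) hyF]
    · rwa [tight_update_of_ne hj hcj hxb]

theorem mem_tightComplex_update (h : IsSimplePresentation l c) (hj : l j = 0) (hcj : c j = 1)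
    (hF : ∀ x ∈ tightFace l c τ, b < m x)
    (hV : ∀ x ∈ (polyhedron l c).extremePoints ℝ, x ∉ tightFace l c τ → m x < b)
    {σ : Set I} (hσ : j ∉ σ) :
    σ ∈ tightComplex (Function.update l j m) (Function.update c j b) ↔
      σ ∈ tightComplex l c ∧ ¬ τ ⊆ σ := by
  simp only [tightComplex, Set.mem_ofPred_eq]
  rw [tightFace_update hj hcj hσ]
  constructor
  · rintro ⟨x, hx, hxb⟩
    exact ⟨⟨x, hx⟩, fun hsub => (hF x (tightFace_anti hsub hx)).not_ge hxb⟩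
  · rintro ⟨hσK, hτ⟩
    obtain ⟨x, hx, hxσ, hxτ⟩ := h.exists_extremePoint_notMem_tightFace hσK hτ
    exact ⟨x, hxσ, (hV x hx hxτ).le⟩

/-- If the cut meets the face of σ, a vertex of that face maximising m is not below the cut, so it
lies in the face of τ. Conversely, m crosses b between a vertex of the face outside τ and a point of
it in τ. -/
theorem insert_mem_tightComplex_update (h : IsSimplePresentation l c) (hj : l j = 0)
    (hcj : c j = 1) (hF : ∀ x ∈ tightFace l c τ, b < m x)
    (hV : ∀ x ∈ (polyhedron l c).extremePoints ℝ, x ∉ tightFace l c τ → m x < b)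
    {σ : Set I} (hσ : j ∉ σ) :
    insert j σ ∈ tightComplex (Function.update l j m) (Function.update c j b) ↔
      σ ∪ τ ∈ tightComplex l c ∧ ¬ τ ⊆ σ := by
  simp only [tightComplex, Set.mem_ofPred_eq]
  rw [tightFace_update_insert hj hcj hσ]
  constructor
  · rintro ⟨x, hx, hxb⟩
    refine ⟨?_, fun hsub => (hF x (tightFace_anti hsub hx)).ne' hxb⟩
    obtain ⟨y, hy, hmax⟩ := exists_extremePoint_isMax (h.isCompact_tightFace σ) ⟨x, hx⟩ m
    rw [← tightFace_inter]
    refine ⟨y, hy.1, ?_⟩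
    by_contra hyF
    have h1 := hV y (extremePoints_tightFace_subset _ hy) hyF
    have h2 := hmax x hx
    linarith
  · rintro ⟨⟨y, hy⟩, hτ⟩
    rw [← tightFace_inter] at hy
    obtain ⟨x, hx, hxσ, hxτ⟩ := h.exists_extremePoint_notMem_tightFace ⟨y, hy.1⟩ hτ
    exact (convex_tightFace σ).isPreconnected.intermediate_value hxσ hy.1
      m.continuous.continuousOn ⟨(hV x hx hxτ).le, (hF y hy.2).le⟩

end IsSimplePresentation

end Truncation

end GraphCubeahedron

namespace GraphCubeahedron

/-! ### Nested label sets under stellar subdivision. -/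

section Combinatorics

variable {V : Type*}

/-- Labels of the facets of the partially truncated cube. -/
inductive Label (V : Type*) : Type _
  | round (v : V)
  | square (v : V)
  | tube (t : Set V)

instance [Finite V] : Finite (Label V) := by
  refine Finite.of_injective
    (fun | .round v => Sum.inl v | .square v => Sum.inr (Sum.inl v) | .tube t => Sum.inr (Sum.inr t) :
      Label V → V ⊕ V ⊕ Set V) ?_
  rintro (_ | _ | _) (_ | _ | _) h <;> simp_all

/-- The sets of labels of facets with a common point, when the faces labeled by `T` have been
truncated. -/
structure IsNestedFor (T : Set (Set V)) (σ : Set (Label V)) : Prop where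
  tube_mem : ∀ a, Label.tube a ∈ σ → a ∈ T
  round_notMem : ∀ v, Label.square v ∈ σ → Label.round v ∉ σ
  notMem_tube : ∀ v, Label.square v ∈ σ → ∀ a, Label.tube a ∈ σ → v ∉ a
  exists_free : ∀ u ∈ T, ∃ v ∈ u, Label.round v ∉ σ ∧ ∀ a, Label.tube a ∈ σ → a ⊂ u → v ∉ a

variable [Finite V] {T : Set (Set V)} {t : Set V} {σ : Set (Label V)}

/-- By minimality of t no chosen tube lies properly inside it, so only round labels can cover it. -/
theorem exists_free_iff (hmin : ∀ u ∈ T, t.ncard ≤ u.ncard)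
    (hσ : ∀ a, Label.tube a ∈ σ → a ∈ T) :
    (∃ v ∈ t, Label.round v ∉ σ ∧ ∀ a, Label.tube a ∈ σ → a ⊂ t → v ∉ a) ↔
      ¬ Label.round '' t ⊆ σ := by
  rw [Set.image_subset_iff, Set.not_subset]
  refine exists_congr fun v => and_congr_right fun _ => ⟨fun h => h.1, fun h => ⟨h, ?_⟩⟩
  intro a ha hat
  exact absurd (Set.ncard_lt_ncard hat) (hmin a (hσ a ha)).not_gt

theorem isNestedFor_insert (hmin : ∀ u ∈ T, t.ncard ≤ u.ncard)
    (hσ : Label.tube t ∉ σ) :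
    IsNestedFor (insert t T) σ ↔ IsNestedFor T σ ∧ ¬ Label.round '' t ⊆ σ := by
  constructor
  · intro h
    have htube : ∀ a, Label.tube a ∈ σ → a ∈ T := fun a ha =>
      (h.tube_mem a ha).resolve_left fun hat => hσ (hat ▸ ha)
    exact ⟨⟨htube, h.round_notMem, h.notMem_tube, fun u hu => h.exists_free u (Or.inr hu)⟩,
      (exists_free_iff hmin htube).1 (h.exists_free t (Or.inl rfl))⟩
  · rintro ⟨h, hsub⟩
    refine ⟨fun a ha => Or.inr (h.tube_mem a ha), h.round_notMem, h.notMem_tube, ?_⟩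
    rintro u (rfl | hu)
    · exact (exists_free_iff hmin h.tube_mem).2 hsub
    · exact h.exists_free u hu

theorem isNestedFor_insert_insert (htT : t ∉ T) (hmin : ∀ u ∈ T, t.ncard ≤ u.ncard)
    (hunion : ∀ u ∈ T, (t ∩ u).Nonempty → t ∪ u ∈ T) (hσ : Label.tube t ∉ σ) :
    IsNestedFor (insert t T) (insert (Label.tube t) σ) ↔
      IsNestedFor T (σ ∪ Label.round '' t) ∧ ¬ Label.round '' t ⊆ σ := by
  have hround : ∀ v, Label.round v ∈ σ ∪ Label.round '' t ↔ Label.round v ∈ σ ∨ v ∈ t := by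
    simp
  have hsq : ∀ v, Label.square v ∈ σ ∪ Label.round '' t ↔ Label.square v ∈ σ := by simp
  have htb : ∀ a, Label.tube a ∈ σ ∪ Label.round '' t ↔ Label.tube a ∈ σ := by simp
  have hround' : ∀ v, Label.round v ∈ insert (Label.tube t) σ ↔ Label.round v ∈ σ := by simp
  have hsq' : ∀ v, Label.square v ∈ insert (Label.tube t) σ ↔ Label.square v ∈ σ := by simp
  have htb' : ∀ a, Label.tube a ∈ insert (Label.tube t) σ ↔ a = t ∨ Label.tube a ∈ σ := by simp
  constructor
  · intro h
    have htube : ∀ a, Label.tube a ∈ σ → a ∈ T := fun a ha =>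
      (h.tube_mem a ((htb' a).2 (Or.inr ha))).resolve_left fun hat => hσ (hat ▸ ha)
    have hsub : ¬ Label.round '' t ⊆ σ := by
      rw [← exists_free_iff hmin htube]
      obtain ⟨v, hv, h1, h2⟩ := h.exists_free t (Or.inl rfl)
      exact ⟨v, hv, fun h => h1 ((hround' v).2 h), fun a ha => h2 a ((htb' a).2 (Or.inr ha))⟩
    refine ⟨⟨fun a ha => htube a ((htb a).1 ha), fun v hv hr => ?_, fun v hv a ha => ?_,
      fun u hu => ?_⟩, hsub⟩
    · have hv' := (hsq' v).2 ((hsq v).1 hv)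
      rcases (hround v).1 hr with hr | hr
      · exact h.round_notMem v hv' ((hround' v).2 hr)
      · exact h.notMem_tube v hv' t ((htb' t).2 (Or.inl rfl)) hr
    · exact h.notMem_tube v ((hsq' v).2 ((hsq v).1 hv)) a ((htb' a).2 (Or.inr ((htb a).1 ha)))
    · by_cases hint : (t ∩ u).Nonempty
      · have hne : t ≠ t ∪ u := fun heq => htT (heq ▸ hunion u hu hint)
        obtain ⟨v, hv, h1, h2⟩ := h.exists_free (t ∪ u) (Or.inr (hunion u hu hint))
        have hvt : v ∉ t := h2 t ((htb' t).2 (Or.inl rfl))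
          (Set.subset_union_left.ssubset_of_ne hne)
        refine ⟨v, hv.resolve_left hvt, fun hr => ?_, fun a ha hau => ?_⟩
        · exact ((hround v).1 hr).elim (fun hr => h1 ((hround' v).2 hr)) hvt
        · exact h2 a ((htb' a).2 (Or.inr ((htb a).1 ha)))
            (hau.trans_subset Set.subset_union_right)
      · obtain ⟨v, hv, h1, h2⟩ := h.exists_free u (Or.inr hu)
        refine ⟨v, hv, fun hr => ?_, fun a ha hau => ?_⟩
        · exact ((hround v).1 hr).elim (fun hr => h1 ((hround' v).2 hr))
            fun hvt => hint ⟨v, hvt, hv⟩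
        · exact h2 a ((htb' a).2 (Or.inr ((htb a).1 ha))) hau
  · rintro ⟨h, hsub⟩
    have htube : ∀ a, Label.tube a ∈ σ → a ∈ T := fun a ha => h.tube_mem a ((htb a).2 ha)
    refine ⟨fun a ha => ((htb' a).1 ha).imp id (htube a), fun v hv hr => ?_,
      fun v hv a ha hva => ?_, ?_⟩
    · exact h.round_notMem v ((hsq v).2 ((hsq' v).1 hv)) ((hround v).2 (Or.inl ((hround' v).1 hr)))
    · have hv' := (hsq v).2 ((hsq' v).1 hv)
      rcases (htb' a).1 ha with rfl | ha
      · exact h.round_notMem v hv' ((hround v).2 (Or.inr hva))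
      · exact h.notMem_tube v hv' a ((htb a).2 ha) hva
    · rintro u (rfl | hu)
      · obtain ⟨v, hv, h1, h2⟩ := (exists_free_iff hmin htube).2 hsub
        refine ⟨v, hv, fun hr => h1 ((hround' v).1 hr), fun a ha hau => ?_⟩
        rcases (htb' a).1 ha with rfl | ha
        · exact absurd hau (ssubset_irrefl _)
        · exact h2 a ha hau
      · obtain ⟨v, hv, h1, h2⟩ := h.exists_free u hu
        refine ⟨v, hv, fun hr => h1 ((hround v).2 (Or.inl ((hround' v).1 hr))), fun a ha hau => ?_⟩
        rcases (htb' a).1 ha with rfl | ha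
        · exact fun hva => h1 ((hround v).2 (Or.inr hva))
        · exact h2 a ((htb a).2 ha) hau

/-- The face labeled by `t` is still there as long as only labels at least as large have been truncated. -/
theorem isNestedFor_image_round (htT : t ∉ T) (hmin : ∀ u ∈ T, t.ncard ≤ u.ncard) :
    IsNestedFor T (Label.round '' t) where
  tube_mem := by simp
  round_notMem := by simp
  notMem_tube := by simp
  exists_free u hu := by
    have hsub : ¬ u ⊆ t := fun hsub =>
      htT (Set.eq_of_subset_of_ncard_le hsub (hmin u hu) ▸ hu)
    obtain ⟨v, hvu, hvt⟩ := Set.not_subset.1 hsub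
    exact ⟨v, hvu, by simpa using hvt, by simp⟩

end Combinatorics

/-! ### Nested label sets are design tubings. -/

section Tubings

variable {V : Type*} {G : SimpleGraph V}

theorem IsRoundTube.union {s t : Set V} (hs : IsRoundTube G s) (ht : IsRoundTube G t)
    (h : (s ∩ t).Nonempty) : IsRoundTube G (s ∪ t) :=
  SimpleGraph.induce_union_connected hs.preconnected ht.preconnected h

theorem IsRoundTube.union_of_adj {s t : Set V} (hs : IsRoundTube G s) (ht : IsRoundTube G t)
    {v w : V} (hv : v ∈ s) (hw : w ∈ t) (h : G.Adj v w) : IsRoundTube G (s ∪ t) :=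
  SimpleGraph.connected_induce_union hs.preconnected ht.preconnected hv hw h

theorem IsRoundTube.nonempty {t : Set V} (ht : IsRoundTube G t) : t.Nonempty :=
  Set.nonempty_coe_sort.1 (SimpleGraph.Connected.nonempty ht)

theorem isRoundTube_singleton (v : V) : IsRoundTube G {v} := by
  unfold IsRoundTube
  have : Nonempty ({v} : Set V) := ⟨⟨v, rfl⟩⟩
  exact ⟨fun x y => by rw [Subsingleton.elim x y]⟩

theorem IsRoundTube.exists_adj {s u : Set V} (hu : IsRoundTube G u) (hs : s.Nonempty)
    (hsu : s ⊂ u) : ∃ x ∈ s, ∃ y ∈ u, y ∉ s ∧ G.Adj x y := by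
  obtain ⟨x, hx⟩ := hs
  obtain ⟨y, hyu, hys⟩ := Set.exists_of_ssubset hsu
  obtain ⟨p⟩ := hu.preconnected ⟨x, hsu.subset hx⟩ ⟨y, hyu⟩
  obtain ⟨d, -, hd1, hd2⟩ := p.exists_boundary_dart (Subtype.val ⁻¹' s) hx hys
  exact ⟨d.fst, hd1, d.snd, d.snd.2, hd2, d.adj⟩

/-- The label of the facet that represents a design tube. -/
def DesignTube.label : DesignTube G → Label V
  | .round t _ => .tube t
  | .square v => .square v

theorem DesignTube.label_injective : Function.Injective (DesignTube.label (G := G)) := by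
  rintro (_ | _) (_ | _) h <;> simp_all [DesignTube.label]

theorem IsNestedFor.exists_designTubing {σ : Set (Label V)}
    (h : IsNestedFor {t | IsRoundTube G t} σ) :
    ∃ U : DesignTubing G, DesignTube.label '' U.tubes = σ := by
  -- Two chosen tubes that are not nested are proper subsets of their union and leave it no free
  -- node.
  have key : ∀ a b : Set V, IsRoundTube G (a ∪ b) → Label.tube a ∈ σ → Label.tube b ∈ σ →
      ¬ a ⊆ b → ¬ b ⊆ a → False := by
    intro a b hab ha hb h1 h2
    obtain ⟨v, hv, -, hfree⟩ := h.exists_free _ hab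
    rcases hv with hv | hv
    · exact hfree a ha ⟨Set.subset_union_left, fun hs => h2 (Set.subset_union_right.trans hs)⟩ hv
    · exact hfree b hb ⟨Set.subset_union_right, fun hs => h1 (Set.subset_union_left.trans hs)⟩ hv
  refine ⟨⟨DesignTube.label ⁻¹' σ, ?_⟩, ?_⟩
  · rintro (⟨a, ha⟩ | v) hx (⟨b, hb⟩ | w) hy hne
    · refine ⟨fun _ => ⟨fun ⟨hdisj, hconn⟩ => ?_, fun ⟨hint, h1, h2⟩ => ?_⟩,
        fun h => (h ⟨trivial, trivial⟩).elim⟩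
      · change a ∩ b = ∅ at hdisj
        refine key a b hconn hx hy (fun hs => ?_) fun hs => ?_
        · rw [Set.inter_eq_left.2 hs] at hdisj
          exact ha.nonempty.ne_empty hdisj
        · rw [Set.inter_eq_right.2 hs] at hdisj
          exact hb.nonempty.ne_empty hdisj
      · exact key a b (ha.union hb hint) hx hy h1 h2
    · refine ⟨fun h => h.2.elim, fun _ hn => h.notMem_tube w hy a hx ?_⟩
      rcases hn with hn | hn
      · obtain ⟨z, hz⟩ := ha.nonempty
        exact Set.mem_singleton_iff.1 (hn hz) ▸ hz
      · exact hn rfl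
    · refine ⟨fun h => h.1.elim, fun _ hn => h.notMem_tube v hx b hy ?_⟩
      rcases hn with hn | hn
      · exact hn rfl
      · obtain ⟨z, hz⟩ := hb.nonempty
        exact Set.mem_singleton_iff.1 (hn hz) ▸ hz
    · refine ⟨fun h => h.1.elim, fun _ hn => hne ?_⟩
      rcases hn with hn | hn
      · rw [Set.mem_singleton_iff.1 (hn rfl : v ∈ ({w} : Set V))]
      · rw [Set.mem_singleton_iff.1 (hn rfl : w ∈ ({v} : Set V))]
  · refine Set.image_preimage_eq_of_subset ?_
    rintro (v | v | t) hi
    -- The singleton {v} is a tube, and its only possible free node is v, so v carries no round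
    -- label.
    · obtain ⟨w, hw, hwσ, -⟩ := h.exists_free {v} (isRoundTube_singleton v)
      rw [Set.mem_singleton_iff.1 hw] at hwσ
      exact absurd hi hwσ
    · exact ⟨.square v, rfl⟩
    · exact ⟨.round t (h.tube_mem t hi), rfl⟩

variable [Finite V]

theorem isNestedFor_image_label (U : DesignTubing G) :
    IsNestedFor {t | IsRoundTube G t} (DesignTube.label '' U.tubes) := by
  have htube : ∀ a, Label.tube a ∈ DesignTube.label '' U.tubes →
      ∃ ha : IsRoundTube G a, DesignTube.round a ha ∈ U.tubes := by
    rintro a ⟨b | b, hb, h⟩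
    · cases h; exact ⟨_, hb⟩
    · cases h
  have hsq : ∀ v, Label.square v ∈ DesignTube.label '' U.tubes → .square v ∈ U.tubes := by
    rintro v ⟨b | b, hb, h⟩
    · cases h
    · cases h; exact hb
  have hround : ∀ v, Label.round v ∉ DesignTube.label '' U.tubes := by
    rintro v ⟨b | b, hb, h⟩ <;> cases h
  refine ⟨fun a ha => (htube a ha).1, fun v _ => hround v, fun v hv a ha hva => ?_,
    fun u hu => ?_⟩
  · obtain ⟨ha', haU⟩ := htube a ha
    have := (U.pairwise_compatible (hsq v hv) haU (by simp)).2 (by simp [DesignTube.IsRound])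
    exact this (Or.inl (by simpa [DesignTube.nodes] using hva))
  · by_contra hcov
    have hcov' : ∀ v ∈ u, ∃ a, Label.tube a ∈ DesignTube.label '' U.tubes ∧ a ⊂ u ∧ v ∈ a := by
      intro v hv
      by_contra hno
      exact hcov ⟨v, hv, hround v, fun a ha hau hva => hno ⟨a, ha, hau, hva⟩⟩
    obtain ⟨v₀, hv₀⟩ := IsRoundTube.nonempty hu
    obtain ⟨a₀, ha₀, ha₀u, -⟩ := hcov' v₀ hv₀
    -- An edge leaves the maximal a towards some y ∈ u in another chosen b ⊂ u. If b meets a,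
    -- compatibility forces nesting, contradicting maximality or y ∉ a; if not, the edge makes them
    -- adjacent.
    obtain ⟨a, ⟨ha, hau⟩, hmax⟩ :=
      (Set.toFinite {a | Label.tube a ∈ DesignTube.label '' U.tubes ∧ a ⊂ u}).exists_maximal
        ⟨a₀, ha₀, ha₀u⟩
    obtain ⟨ha', haU⟩ := htube a ha
    obtain ⟨x, hxa, y, hyu, hya, hxy⟩ := IsRoundTube.exists_adj hu ha'.nonempty hau
    obtain ⟨b, hb, hbu, hyb⟩ := hcov' y hyu
    obtain ⟨hb', hbU⟩ := htube b hb
    have hne : a ≠ b := fun h => hya (h ▸ hyb)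
    have hcomp := (U.pairwise_compatible haU hbU (by simpa using hne)).1 ⟨trivial, trivial⟩
    by_cases hint : (a ∩ b).Nonempty
    · exact hcomp.2 ⟨hint, fun hab => hya (hmax ⟨hb, hbu⟩ hab hyb), fun hba => hya (hba hyb)⟩
    · exact hcomp.1 ⟨Set.not_nonempty_iff_eq_empty.1 hint, ha'.union_of_adj hb' hxa hyb hxy⟩

end Tubings

end GraphCubeahedron

namespace GraphCubeahedron

/-! ### The cube and its successive truncations. -/

section TruncatedCubes

variable {V : Type*} [Fintype V]

/-- A family of functionals with a biorthogonal family of vectors is linearly independent. -/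
theorem linearIndependent_of_forall_exists {E : Type*} [NormedAddCommGroup E] [NormedSpace ℝ E]
    {ι : Type*} [Finite ι] {f : ι → StrongDual ℝ E}
    (h : ∀ i, ∃ d, f i d ≠ 0 ∧ ∀ j, j ≠ i → f j d = 0) : LinearIndependent ℝ f := by
  cases nonempty_fintype ι
  rw [Fintype.linearIndependent_iff]
  intro g hg i
  obtain ⟨d, hd, hd'⟩ := h i
  have h1 := congrArg (fun φ : StrongDual ℝ E => φ d) hg
  simp only [FunLike.coe_sum, Finset.sum_apply, smul_apply, smul_eq_mul, zero_apply] at h1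
  rw [Finset.sum_eq_single i (fun j _ hj => by rw [hd' j hj, mul_zero])
    (fun hi => absurd (Finset.mem_univ i) hi)] at h1
  exact (mul_eq_zero.1 h1).resolve_right hd

/-- The functionals in the presentation of the cube. -/
noncomputable def cubeFunctional : Label V → StrongDual ℝ (V → ℝ)
  | .round v => -ContinuousLinearMap.proj v
  | .square v => ContinuousLinearMap.proj v
  | .tube _ => 0

/-- The bounds in the presentation of the cube. -/
def cubeBound : Label V → ℝ
  | .round _ => 0
  | .square _ => 1
  | .tube _ => 1

theorem polyhedron_cube : polyhedron cubeFunctional cubeBound = cube V := by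
  ext x
  constructor
  · intro hx
    refine ⟨fun v => ?_, fun v => hx (.square v)⟩
    simpa [cubeFunctional, cubeBound] using hx (.round v)
  · rintro ⟨h0, h1⟩ (v | v | t)
    · simpa [cubeFunctional, cubeBound] using h0 v
    · exact h1 v
    · simp [cubeFunctional, cubeBound]

theorem round_mem_tight_cube {v : V} {x : V → ℝ} :
    Label.round v ∈ tight cubeFunctional cubeBound x ↔ x v = 0 := by
  simp [tight, cubeFunctional, cubeBound]

theorem square_mem_tight_cube {v : V} {x : V → ℝ} :
    Label.square v ∈ tight cubeFunctional cubeBound x ↔ x v = 1 := by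
  simp [tight, cubeFunctional, cubeBound]

theorem tube_notMem_tight_cube {t : Set V} {x : V → ℝ} :
    Label.tube t ∉ tight cubeFunctional cubeBound x := by
  simp [tight, cubeFunctional, cubeBound]

theorem isSimplePresentation_cube :
    IsSimplePresentation (cubeFunctional (V := V)) cubeBound where
  isCompact := by
    rw [polyhedron_cube]
    exact isCompact_Icc
  linearIndependent x _ := by
    classical
    refine linearIndependent_of_forall_exists ?_
    rintro ⟨v | v | t, hi⟩
    · refine ⟨Pi.single v 1, by simp [cubeFunctional], ?_⟩
      rintro ⟨w | w | s, hj⟩ hne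
      · have : w ≠ v := by rintro rfl; exact hne rfl
        simp [cubeFunctional, this]
      · have : w ≠ v := by
          rintro rfl
          rw [round_mem_tight_cube] at hi
          rw [square_mem_tight_cube, hi] at hj
          exact zero_ne_one hj
        simp [cubeFunctional, this]
      · exact absurd hj tube_notMem_tight_cube
    · refine ⟨Pi.single v 1, by simp [cubeFunctional], ?_⟩
      rintro ⟨w | w | s, hj⟩ hne
      · have : w ≠ v := by
          rintro rfl
          rw [square_mem_tight_cube] at hi
          rw [round_mem_tight_cube, hi] at hj
          exact one_ne_zero hj
        simp [cubeFunctional, this]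
      · have : w ≠ v := by rintro rfl; exact hne rfl
        simp [cubeFunctional, this]
      · exact absurd hj tube_notMem_tight_cube
    · exact absurd hi tube_notMem_tight_cube

theorem mem_tightComplex_cube {σ : Set (Label V)} :
    σ ∈ tightComplex cubeFunctional cubeBound ↔ IsNestedFor ∅ σ := by
  classical
  constructor
  · rintro ⟨x, -, hx⟩
    refine ⟨fun a ha => absurd (hx ha) tube_notMem_tight_cube, fun v hv hr => ?_,
      fun v _ a ha => absurd (hx ha) tube_notMem_tight_cube, by simp⟩
    have h1 := round_mem_tight_cube.1 (hx hr)
    rw [square_mem_tight_cube.1 (hx hv)] at h1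
    exact one_ne_zero h1
  · intro h
    -- A vertex of the cube: unlabeled nodes may take either value, here 0.
    refine ⟨fun v => if Label.square v ∈ σ then 1 else 0, ?_, ?_⟩
    · rw [polyhedron_cube]
      constructor <;> intro v <;> dsimp only <;> split_ifs <;> simp
    · rintro (v | v | t) hi
      · rw [round_mem_tight_cube, if_neg fun hv => h.round_notMem v hv hi]
      · rw [square_mem_tight_cube, if_pos hi]
      · exact absurd (h.tube_mem t hi) (Set.notMem_empty t)

theorem roundFace_eq_tightFace (t : Set V) :
    roundFace t = tightFace cubeFunctional cubeBound (Label.round '' t) := by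
  ext x
  simp only [roundFace, tightFace, polyhedron_cube, Set.mem_ofPred_eq, Set.image_subset_iff]
  exact and_congr_right fun _ => forall₂_congr fun v _ => round_mem_tight_cube.symm

theorem polyDim_roundFace_add (t : Set V) :
    polyDim (roundFace t) + t.ncard = Fintype.card V := by
  have hmem : Label.round '' t ∈ tightComplex (cubeFunctional (V := V)) cubeBound :=
    mem_tightComplex_cube.2 ⟨by simp, by simp, by simp, by simp⟩
  have h := isSimplePresentation_cube.polyDim_tightFace_add hmem
  rwa [← roundFace_eq_tightFace, Set.ncard_image_of_injective _ fun v w h => by cases h; rfl,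
    Module.finrank_fintype_fun_eq_card] at h

/-- A presentation of the polytope obtained from the cube by truncating the faces labeled
by the members of `T`. -/
structure IsTruncatedCube (T : Set (Set V)) (l : Label V → StrongDual ℝ (V → ℝ))
    (c : Label V → ℝ) : Prop where
  simple : IsSimplePresentation l c
  round : ∀ v, l (.round v) = cubeFunctional (.round v) ∧ c (.round v) = 0
  square : ∀ v, l (.square v) = cubeFunctional (.square v) ∧ c (.square v) = 1
  tube : ∀ t ∉ T, l (.tube t) = 0 ∧ c (.tube t) = 1
  mem_tightComplex : ∀ σ, σ ∈ tightComplex l c ↔ IsNestedFor T σ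

theorem isTruncatedCube_empty : IsTruncatedCube (V := V) ∅ cubeFunctional cubeBound where
  simple := isSimplePresentation_cube
  round _ := ⟨rfl, rfl⟩
  square _ := ⟨rfl, rfl⟩
  tube _ _ := ⟨rfl, rfl⟩
  mem_tightComplex _ := mem_tightComplex_cube

namespace IsTruncatedCube

variable {T : Set (Set V)} {t : Set V} {l : Label V → StrongDual ℝ (V → ℝ)} {c : Label V → ℝ}

/-- The inequalities of the cube survive every truncation, so the remainder of a cube face is cut
out by the same round labels. -/
theorem roundFace_inter (h : IsTruncatedCube T l c) (t : Set V) :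
    roundFace t ∩ polyhedron l c = tightFace l c (Label.round '' t) := by
  have hround : ∀ v x, Label.round v ∈ tight l c x ↔ x v = 0 := by
    intro v x
    simp [tight, h.round v, cubeFunctional]
  ext x
  simp only [roundFace, tightFace, Set.mem_inter_iff, Set.mem_ofPred_eq, Set.image_subset_iff]
  constructor
  · rintro ⟨⟨-, h0⟩, hx⟩
    exact ⟨hx, fun v hv => (hround v x).2 (h0 v hv)⟩
  · rintro ⟨hx, h0⟩
    refine ⟨⟨⟨fun v => ?_, fun v => ?_⟩, fun v hv => (hround v x).1 (h0 hv)⟩, hx⟩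
    · simpa [h.round v, cubeFunctional] using hx (.round v)
    · simpa [h.square v, cubeFunctional] using hx (.square v)

theorem exists_isTruncation (h : IsTruncatedCube T l c) (htT : t ∉ T)
    (hmin : ∀ u ∈ T, t.ncard ≤ u.ncard) :
    ∃ Q, IsTruncation (polyhedron l c) (roundFace t ∩ polyhedron l c) Q := by
  rw [h.roundFace_inter]
  exact IsSimplePresentation.exists_isTruncation
    ((h.mem_tightComplex _).2 (isNestedFor_image_round htT hmin))

theorem exists_of_isTruncation (h : IsTruncatedCube T l c) (htT : t ∉ T)
    (hmin : ∀ u ∈ T, t.ncard ≤ u.ncard)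
    (hunion : ∀ u ∈ T, (t ∩ u).Nonempty → t ∪ u ∈ T) {Q : Set (V → ℝ)}
    (hQ : IsTruncation (polyhedron l c) (roundFace t ∩ polyhedron l c) Q) :
    ∃ l' c', IsTruncatedCube (insert t T) l' c' ∧ Q = polyhedron l' c' := by
  classical
  rw [h.roundFace_inter] at hQ
  obtain ⟨-, m, b, hF, hV, rfl⟩ := hQ
  obtain ⟨hl, hc⟩ := h.tube t htT
  refine ⟨Function.update l (.tube t) m, Function.update c (.tube t) b,
    ⟨h.simple.update hl hc hF hV, fun v => ?_, fun v => ?_, fun s hs => ?_, fun σ => ?_⟩,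
    (polyhedron_update hl hc).symm⟩
  · simpa using h.round v
  · simpa using h.square v
  · have hst : s ≠ t := fun hst => hs (Or.inl hst)
    simpa [hst] using h.tube s fun hsT => hs (Or.inr hsT)
  · by_cases hσ : Label.tube t ∈ σ
    · obtain ⟨σ', hσ', rfl⟩ : ∃ σ', Label.tube t ∉ σ' ∧ insert (Label.tube t) σ' = σ :=
        ⟨σ \ {Label.tube t}, by simp, by simp [Set.insert_eq_of_mem hσ]⟩
      rw [h.simple.insert_mem_tightComplex_update hl hc hF hV hσ', h.mem_tightComplex,
        isNestedFor_insert_insert htT hmin hunion hσ']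
    · rw [h.simple.mem_tightComplex_update hl hc hF hV hσ, h.mem_tightComplex,
        isNestedFor_insert hmin hσ]

variable {G : SimpleGraph V}

/-- Truncating the remaining round tubes is possible, and leads to a truncated cube. -/
theorem iteratedTruncation (L : List (Set V)) (hL : L.Nodup) (hLT : ∀ u ∈ L, u ∉ T)
    (htube : ∀ u, IsRoundTube G u ↔ u ∈ T ∨ u ∈ L)
    (hsort : L.Pairwise fun s t => t.ncard ≤ s.ncard)
    (hmin : ∀ t ∈ L, ∀ u ∈ T, t.ncard ≤ u.ncard) (h : IsTruncatedCube T l c) :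
    (∃ Q, IsIteratedTruncation (polyhedron l c) (L.map roundFace) Q) ∧
      ∀ Q, IsIteratedTruncation (polyhedron l c) (L.map roundFace) Q →
        ∃ l' c', IsTruncatedCube {t | IsRoundTube G t} l' c' ∧ Q = polyhedron l' c' := by
  induction L generalizing T l c with
  | nil =>
    have hT : T = {t | IsRoundTube G t} := by
      ext u
      simp [htube u]
    subst hT
    refine ⟨⟨_, rfl⟩, ?_⟩
    rintro Q rfl
    exact ⟨l, c, h, rfl⟩
  | cons t L ih =>
    have htT := hLT t List.mem_cons_self
    have hmint := hmin t List.mem_cons_self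
    rw [List.nodup_cons] at hL
    rw [List.pairwise_cons] at hsort
    -- The union is a tube. Were it still to be cut, it would be no larger than t, hence than u, and
    -- so equal to u, which is already cut.
    have hunion : ∀ u ∈ T, (t ∩ u).Nonempty → t ∪ u ∈ T := by
      intro u hu hint
      have htu : IsRoundTube G (t ∪ u) :=
        IsRoundTube.union ((htube t).2 (Or.inr List.mem_cons_self)) ((htube u).2 (Or.inl hu)) hint
      have hle : u.ncard ≤ (t ∪ u).ncard := Set.ncard_le_ncard Set.subset_union_right
      have hsmall : t ∪ u ∉ T → (t ∪ u).ncard ≤ t.ncard := fun hno => by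
        rcases List.mem_cons.1 (((htube _).1 htu).resolve_left hno) with heq | hmem
        · rw [heq]
        · exact hsort.1 _ hmem
      by_contra hno
      have h1 : u = t ∪ u := Set.eq_of_subset_of_ncard_le Set.subset_union_right
        ((hsmall hno).trans (hmint u hu))
      exact hno (h1 ▸ hu)
    have hstep : ∀ {l' c'}, IsTruncatedCube (insert t T) l' c' →
        (∃ Q, IsIteratedTruncation (polyhedron l' c') (L.map roundFace) Q) ∧
          ∀ Q, IsIteratedTruncation (polyhedron l' c') (L.map roundFace) Q →
            ∃ l' c', IsTruncatedCube {t | IsRoundTube G t} l' c' ∧ Q = polyhedron l' c' := by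
      refine fun h' => ih hL.2 ?_ ?_ hsort.2 ?_ h'
      · rintro u hu (rfl | huT)
        · exact hL.1 hu
        · exact hLT u (List.mem_cons_of_mem _ hu) huT
      · intro u
        rw [htube u, Set.mem_insert_iff, List.mem_cons]
        tauto
      · rintro s hs u (rfl | hu)
        · exact hsort.1 s hs
        · exact hmin s (List.mem_cons_of_mem _ hs) u hu
    constructor
    · obtain ⟨P, hP⟩ := h.exists_isTruncation htT hmint
      obtain ⟨l', c', h', rfl⟩ := h.exists_of_isTruncation htT hmint hunion hP
      obtain ⟨Q, hQ⟩ := (hstep h').1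
      exact ⟨Q, _, hP, hQ⟩
    · rintro Q ⟨P, hP, hQ⟩
      obtain ⟨l', c', h', rfl⟩ := h.exists_of_isTruncation htT hmint hunion hP
      exact (hstep h').2 Q hQ

/-- When all round tubes have been truncated, the dual complex consists of the design tubings. -/
noncomputable def designTubingIso (h : IsTruncatedCube {t | IsRoundTube G t} l c) :
    DesignTubing G ≃o (tightComplex l c)ᵒᵈ where
  toEquiv := Equiv.ofBijective
    (fun U => OrderDual.toDual
      ⟨DesignTube.label '' U.tubes, (h.mem_tightComplex _).2 (isNestedFor_image_label U)⟩) <| by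
      constructor
      · intro U U' heq
        have heq' : DesignTube.label '' U.tubes = DesignTube.label '' U'.tubes :=
          congrArg (fun σ => (OrderDual.ofDual σ).1) heq
        exact DesignTubing.ext (DesignTube.label_injective.image_injective heq')
      · intro σ
        obtain ⟨U, hU⟩ :=
          ((h.mem_tightComplex _).1 (OrderDual.ofDual σ).2).exists_designTubing
        exact ⟨U, congrArg OrderDual.toDual (Subtype.ext hU)⟩
  map_rel_iff' := Set.image_subset_image_iff DesignTube.label_injective

end IsTruncatedCube

/-- The round tubes of a finite graph, listed by decreasing size. -/
theorem exists_list_roundTubes (G : SimpleGraph V) :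
    ∃ L : List (Set V), L.Nodup ∧ (∀ t, t ∈ L ↔ IsRoundTube G t) ∧
      L.Pairwise fun s t => polyDim (roundFace s) ≤ polyDim (roundFace t) := by
  classical
  let r : Set V → Set V → Prop := fun s t => polyDim (roundFace s) ≤ polyDim (roundFace t)
  have : Std.Total r := ⟨fun s t => le_total _ _⟩
  have : IsTrans (Set V) r := ⟨fun s t u => le_trans⟩
  let L₀ := (Set.toFinite {t : Set V | IsRoundTube G t}).toFinset.toList
  refine ⟨L₀.insertionSort r, ?_, fun t => ?_, List.pairwise_insertionSort r L₀⟩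
  · exact (List.perm_insertionSort r L₀).nodup_iff.2 (Finset.nodup_toList _)
  · rw [(List.perm_insertionSort r L₀).mem_iff]
    simp [L₀]

theorem iteratedTruncation_cube {G : SimpleGraph V} {L : List (Set V)} (hL : L.Nodup)
    (htube : ∀ t, t ∈ L ↔ IsRoundTube G t)
    (hsort : L.Pairwise fun s t => polyDim (roundFace s) ≤ polyDim (roundFace t)) :
    (∃ Q, IsIteratedTruncation (cube V) (L.map roundFace) Q) ∧
      ∀ Q, IsIteratedTruncation (cube V) (L.map roundFace) Q →
        ∃ l' c', IsTruncatedCube {t | IsRoundTube G t} l' c' ∧ Q = polyhedron l' c' := by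
  rw [← polyhedron_cube]
  refine isTruncatedCube_empty.iteratedTruncation L hL (by simp) (by simp [htube])
    (hsort.imp fun {s t} hst => ?_) (by simp)
  have h1 := polyDim_roundFace_add s
  have h2 := polyDim_roundFace_add t
  omega

end TruncatedCubes

end GraphCubeahedron

open GraphCubeahedron
theorem theorem12 {V : Type*} [Fintype V] (G : SimpleGraph V) (n : ℕ)
    (hn : Fintype.card V = n) :
    (∃ P : Set (V → ℝ), IsGraphCubeahedron G P) ∧
      ∀ P : Set (V → ℝ), IsGraphCubeahedron G P →
        IsSimplePolytope P ∧ polyDim P = n ∧ Nonempty (FacePoset P ≃o DesignTubing G) := by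
  constructor
  · obtain ⟨L, hL, htube, hsort⟩ := exists_list_roundTubes G
    obtain ⟨P, hP⟩ := (iteratedTruncation_cube hL htube hsort).1
    exact ⟨P, L, hL, htube, hsort, hP⟩
  · rintro P ⟨L, hL, htube, hsort, hP⟩
    obtain ⟨l, c, h, rfl⟩ := (iteratedTruncation_cube hL htube hsort).2 P hP
    have hne : (polyhedron l c).Nonempty := by
      rw [← tightFace_empty]
      -- The empty tubing corresponds to the polytope itself, which is therefore nonempty.
      have hmem := (h.mem_tightComplex _).2 (isNestedFor_image_label (G := G) ⟨∅, by simp⟩)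
      rwa [Set.image_empty] at hmem
    refine ⟨h.simple.isSimplePolytope hne, ?_, ⟨?_⟩⟩
    · rw [h.simple.polyDim_polyhedron hne, Module.finrank_fintype_fun_eq_card, hn]
    · exact (h.designTubingIso.trans h.simple.facePosetIso).symm
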